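/- For a number field $K$ with ring of integers $\mathcal{O}_K$ and for an integer $q\ge 1$, let $\Pi_q(K)$ be the product of all maximal ideals $\mathfrak{m}$ of $\mathcal{O}_K$ with $|\mathcal{O}_K/\mathfrak{m}|=q$ (so $\Pi_q(K)=\mathcal{O}_K$ if there are none), and let the Pólya group $\mathrm{Po}(K)$ be the subgroup of the class group $\mathrm{Cl}(K)$ generated by the classes of the ideals $\Pi_q(K)$, $q\ge 1$. For an extension of number fields $K\subseteq L$, let $\varepsilon_K^L:\mathrm{Cl}(K)\to\mathrm{Cl}(L)$ be the homomorphism $[I]\mapsto[I\mathcal{O}_L]$. Such an extension $L/K$ is tamely ramified with respect to a prime number $p$ if $p$ divides no ramification index $e(\mathfrak{P}/\mathfrak{P}\cap\mathcal{O}_K)$ of a prime $\mathfrak{P}$ of $\mathcal{O}_L$ above $p$. Let $K_1$ and $K_2$ be two finite Galois extensions of $\mathbb{Q}$ (inside a common field), let $K_0=K_1\cap K_2$ and $L=K_1K_2$. If, for each prime number $p$, at least one of the extensions $K_1/K_0$ and $K_2/K_0$ is tamely ramified with respect to $p$, then $$\mathrm{Po}(L)=\varepsilon_{K_1}^L(\mathrm{Po}(K_1))+\varepsilon_{K_2}^L(\mathrm{Po}(K_2)),$$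 where $+$ denotes the subgroup of the (abelian) class group $\mathrm{Cl}(L)$ generated by the two subgroups. -/

import Mathlib

open scoped NumberField nonZeroDivisors

noncomputable section

namespace PolyaGroup

/-- The ideal `Π_q(K)`: the product of all maximal ideals of `𝓞 K` of norm `q`, that is, with
residue field of cardinality `q` (there are finitely many). It is the unit ideal if there is no
such maximal ideal. -/
def ostrowskiIdeal (K : Type*) [Field K] [NumberField K] (q : ℕ) : Ideal (𝓞 K) :=
  ∏ᶠ m ∈ {m : Ideal (𝓞 K) | m.IsMaximal ∧ Nat.card (𝓞 K ⧸ m) = q}, m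

/-- The product defining `ostrowskiIdeal` is finite. -/
theorem finite_maximal_of_norm (K : Type*) [Field K] [NumberField K] (q : ℕ) :
    {m : Ideal (𝓞 K) | m.IsMaximal ∧ Nat.card (𝓞 K ⧸ m) = q}.Finite :=
  (Ideal.finite_setOfPred_absNorm_le (S := 𝓞 K) q).subset fun m hm => by
    have h : Ideal.absNorm m = q := hm.2
    exact h.le

theorem ostrowskiIdeal_mem (K : Type*) [Field K] [NumberField K] (q : ℕ) :
    ostrowskiIdeal K q ∈ (Ideal (𝓞 K))⁰ := by
  unfold ostrowskiIdeal
  refine finprod_mem_induction (· ∈ (Ideal (𝓞 K))⁰) (one_mem _) (fun _ _ => mul_mem) ?_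
  intro m hm
  exact mem_nonZeroDivisors_iff_ne_zero.mpr
    (Ring.ne_bot_of_isMaximal_of_not_isField hm.1 (NumberField.RingOfIntegers.not_isField K))

/-- The Pólya group of a number field: the subgroup of the class group generated by the classes of
the ideals `Π_q(K)`, `q ≥ 1`. -/
def polyaGroup (K : Type*) [Field K] [NumberField K] : Subgroup (ClassGroup (𝓞 K)) :=
  Subgroup.closure
    {c | ∃ q : ℕ, 0 < q ∧ c = ClassGroup.mk0 ⟨ostrowskiIdeal K q, ostrowskiIdeal_mem K q⟩}

/-- The extension of number fields `K / F` is tamely ramified with respect to the prime number `p`: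
no ramification index `e(P / P ∩ 𝓞 F)` of a prime `P` of `𝓞 K` above `p` is divisible by `p`.
(Residue fields are finite, so that the residue extensions are automatically separable.) -/
def TamelyRamifiedAt (F K : Type*) [Field F] [Field K] [Algebra F K] (p : ℕ) : Prop :=
  ∀ P : Ideal (𝓞 K), P.IsPrime → (p : 𝓞 K) ∈ P → ¬ p ∣ P.ramificationIdx (𝓞 F)

/-- `TamelyRamifiedAt` for two intermediate fields `F ≤ K`, where `K` is an extension of `F` through
the inclusion. -/
def TamelyRamifiedAtOfLE {L : Type*} [Field L] [NumberField L] {F K : IntermediateField ℚ L}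
    (h : F ≤ K) (p : ℕ) : Prop :=
  letI : Algebra F K := (IntermediateField.inclusion h).toRingHom.toAlgebra
  TamelyRamifiedAt F K p

end PolyaGroup

end

/-!
For a Galois number field `K` and a rational prime `p`, the primes of `K` above `p` are conjugate
and hence have the same norm, while primes above different rational primes have different norms.
So the nontrivial ideals `Π_q(K)` are exactly the products `Π_p` of all primes above a rational
prime `p`, and the Pólya group is generated by their classes (`PolyaGroup.polyaGroup_eq_closure`).

For Galois number fields `K ≤ L`, the ideal `Π_p` of `K` extends to `Π_p ^ e` in `L`, where `e` is
the ramification index of `L / K` above `p` (`PolyaGroup.map_primesOverProd`). The image of the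
Pólya group of `K` in the class group of `L` is therefore generated by the `e`-th powers of the
generators of the Pólya group of `L`. It remains to see that the ramification indices of `L / K₁`
and `L / K₂` above each `p` are coprime (`PolyaGroup.coprime_ramificationIdx`), for then a Bézout
relation expresses the class of `Π_p` by these two powers.

The coprimality is a form of Abhyankar's lemma. The inertia groups `I₁`, `I₂` of a prime `P` of `L`
over `K₁`, `K₂` commute and meet trivially, so that `|I₁| |I₂|` divides the order of the inertia
group over `K₀ = K₁ ⊓ K₂`. Hence `|I₂|` divides the ramification index of `K₁ / K₀`, and is prime
to `p` if `K₁ / K₀` is tame; likewise with the two indices exchanged. A common prime factor `l` of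
`|I₁|` and `|I₂|` is thus different from `p`, and by Cauchy's theorem both groups contain elements
of order `l`. These act on the line `P / P ^ 2` over the residue field by `l`-th roots of unity, and
an element of order `l ≠ p` that acts there trivially is trivial. As the `l`-th roots of unity in a
field form a cyclic group, one of the two elements is a power of the other
(`Ideal.exists_eq_pow_of_mem_inertia`), which contradicts `I₁ ⊓ I₂ = 1`.
-/

/-! ### The action of the inertia group on the quotients `P ^ n / P ^ (n + 1)` -/

namespace Ideal

section InertiaAction

variable {S G : Type*} [CommRing S] [Group G] [MulSemiringAction G S] {P : Ideal S} {g h : G}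

theorem smul_mem_of_mem_inertia (hg : g ∈ P.inertia G) {x : S} (hx : x ∈ P) : g • x ∈ P := by
  simpa using add_mem hx (show g • x - x ∈ P from hg x)

theorem smul_mem_sq_of_mem_inertia (hg : g ∈ P.inertia G) {x : S} (hx : x ∈ P ^ 2) :
    g • x ∈ P ^ 2 := by
  rw [pow_two] at hx ⊢
  induction hx using Submodule.mul_induction_on' with
  | mem_mul_mem y hy z hz =>
    rw [smul_mul']
    exact mul_mem_mul (smul_mem_of_mem_inertia hg hy) (smul_mem_of_mem_inertia hg hz)
  | add y _ z _ hy hz => rw [smul_add]; exact add_mem hy hz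

/-- If `g` acts trivially on `S ⧸ P` and on `P ⧸ P ^ 2`, it acts trivially on each
`P ^ n ⧸ P ^ (n + 1)`, which is spanned by products of `n` elements of `P`. -/
theorem smul_sub_mem_pow_succ (hg : g ∈ P.inertia G)
    (hg2 : ∀ x ∈ P, g • x - x ∈ P ^ 2) (n : ℕ) {x : S} (hx : x ∈ P ^ n) :
    g • x - x ∈ P ^ (n + 1) := by
  induction n generalizing x with
  | zero => simpa using hg x
  | succ n ih =>
    rw [pow_succ] at hx
    induction hx using Submodule.mul_induction_on' with
    | mem_mul_mem y hy z hz =>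
      have h2 : (g • y - y) * (g • z) ∈ P ^ (n + 1) * P ^ 1 :=
        mul_mem_mul (ih hy) (by simpa using smul_mem_of_mem_inertia hg hz)
      have h3 : y * (g • z - z) ∈ P ^ n * P ^ 2 := mul_mem_mul hy (hg2 z hz)
      rw [← pow_add] at h2 h3
      rw [smul_mul']
      convert add_mem h2 h3 using 1
      ring
    | add y _ z _ hy hz =>
      rw [smul_add]
      convert add_mem hy hz using 1
      ring

/-- If `g` acts trivially on `S ⧸ P` and on `P ⧸ P ^ 2`, the displacement `g • x - x` is additive
in powers of `g`, up to an error of higher order than the displacement itself. -/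
theorem pow_smul_sub_sub_nsmul_mem (hg : g ∈ P.inertia G)
    (hg2 : ∀ x ∈ P, g • x - x ∈ P ^ 2) {n : ℕ} {x : S} (hx : g • x - x ∈ P ^ n) (k : ℕ) :
    g ^ k • x - x - k • (g • x - x) ∈ P ^ (n + 1) := by
  induction k with
  | zero => simp
  | succ k ih =>
    have h2 : g • (g ^ k • x - x) - (g ^ k • x - x) ∈ P ^ (n + 1) := by
      refine smul_sub_mem_pow_succ hg hg2 n ?_
      simpa using add_mem (pow_le_pow_right n.le_succ ih) (nsmul_mem hx k)
    have h3 := add_mem h2 ih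
    rw [smul_sub] at h3
    rw [pow_succ' g, mul_smul, succ_nsmul]
    convert h3 using 1
    ring

/-- An element of order prime to the residue characteristic that acts trivially on `S ⧸ P` and on
`P ⧸ P ^ 2` is trivial: it acts trivially on `S ⧸ P ^ n` for all `n`, by induction on `n`. -/
theorem eq_one_of_pow_eq_one_of_smul_sub_mem_sq [IsDedekindDomain S] [FaithfulSMul G S]
    [P.IsPrime] (hg : g ∈ P.inertia G)
    (hg2 : ∀ x ∈ P, g • x - x ∈ P ^ 2) {l : ℕ} (hl : (l : S) ∉ P) (hgl : g ^ l = 1) :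
    g = 1 := by
  refine FaithfulSMul.eq_of_smul_eq_smul (α := S) fun x => ?_
  have key : ∀ n, g • x - x ∈ P ^ n := by
    intro n
    induction n with
    | zero => simp
    | succ n ih =>
      have h1 := pow_smul_sub_sub_nsmul_mem hg hg2 ih l
      rw [hgl, one_smul, sub_self, zero_sub, neg_mem_iff, nsmul_eq_mul] at h1
      exact (IsPrime.mul_mem_pow P h1).resolve_left hl
  have hbot : g • x - x ∈ ⨅ n : ℕ, P ^ n := by simpa [mem_iInf] using key
  rw [iInf_pow_eq_bot_of_isDomain P IsPrime.ne_top', mem_bot, sub_eq_zero] at hbot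
  rw [hbot, one_smul]

/-- An element of the inertia group acts on `P ⧸ P ^ 2`, a line over the residue field, by a
scalar. -/
theorem exists_smul_sub_mul_mem_sq [IsDedekindDomain S] [P.IsPrime] (hP : P ≠ ⊥)
    (hg : g ∈ P.inertia G) : ∃ c : S, ∀ x ∈ P, g • x - c * x ∈ P ^ 2 := by
  obtain ⟨a, ha, ha2⟩ := Set.exists_of_ssubset (pow_succ_lt_pow hP 1)
  rw [SetLike.mem_coe] at ha ha2
  have hga : g • a ∈ P := smul_mem_of_mem_inertia hg (by simpa using ha)
  obtain ⟨c, e, he, hc⟩ :=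
    exists_mul_add_mem_pow_succ hP a (g • a) ha ha2 (by simpa using hga)
  refine ⟨c, fun x hx => ?_⟩
  obtain ⟨d, r, hr, rfl⟩ := exists_mul_add_mem_pow_succ hP a x ha ha2 (by simpa using hx)
  have h1 : (g • a) * (g • d - d) ∈ P ^ 2 := by
    rw [pow_two]; exact mul_mem_mul hga (hg d)
  convert add_mem (add_mem h1 (mul_mem_left (P ^ 2) d he))
    (sub_mem (smul_mem_sq_of_mem_inertia hg hr) (mul_mem_left (P ^ 2) c hr)) using 1
  rw [smul_add, smul_mul']
  linear_combination -d * hc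

theorem mul_smul_sub_mul_mem_sq (hh : h ∈ P.inertia G) {c d : S}
    (hc : ∀ x ∈ P, g • x - c * x ∈ P ^ 2) (hd : ∀ x ∈ P, h • x - d * x ∈ P ^ 2) :
    ∀ x ∈ P, (g * h) • x - (c * d) * x ∈ P ^ 2 := by
  intro x hx
  convert add_mem (hc _ (smul_mem_of_mem_inertia hh hx)) (mul_mem_left (P ^ 2) c (hd x hx)) using 1
  rw [mul_smul]
  ring

theorem pow_smul_sub_mul_mem_sq (hg : g ∈ P.inertia G) {c : S}
    (hc : ∀ x ∈ P, g • x - c * x ∈ P ^ 2) (k : ℕ) :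
    ∀ x ∈ P, g ^ k • x - c ^ k * x ∈ P ^ 2 := by
  induction k with
  | zero => simp
  | succ k ih =>
    rw [pow_succ g, pow_succ c]
    exact mul_smul_sub_mul_mem_sq hg ih hc

/-- The scalar by which `g` acts on `P ⧸ P ^ 2` is unique modulo `P`, so that a relation `g ^ l = 1`
makes it a root of unity in the residue field. -/
theorem quotient_mk_pow_eq_one [IsDedekindDomain S] [P.IsPrime] (hP : P ≠ ⊥)
    (hg : g ∈ P.inertia G) {c : S} (hc : ∀ x ∈ P, g • x - c * x ∈ P ^ 2) {l : ℕ}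
    (hgl : g ^ l = 1) : Ideal.Quotient.mk P c ^ l = 1 := by
  obtain ⟨a, ha, ha2⟩ := Set.exists_of_ssubset (pow_succ_lt_pow hP 1)
  rw [SetLike.mem_coe] at ha ha2
  have h1 := pow_smul_sub_mul_mem_sq hg hc l a (by simpa using ha)
  rw [hgl, one_smul] at h1
  rw [← map_pow, ← map_one (Ideal.Quotient.mk P), eq_comm, Ideal.Quotient.mk_eq_mk_iff_sub_mem]
  refine mem_prime_of_mul_mem_pow hP ha2 ?_
  convert h1 using 1
  ring

theorem smul_sub_mem_sq_of_quotient_mk_eq_one {c : S}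
    (hc : ∀ x ∈ P, g • x - c * x ∈ P ^ 2) (h1 : Ideal.Quotient.mk P c = 1) :
    ∀ x ∈ P, g • x - x ∈ P ^ 2 := by
  intro x hx
  rw [← map_one (Ideal.Quotient.mk P), Ideal.Quotient.mk_eq_mk_iff_sub_mem] at h1
  have h2 : (c - 1) * x ∈ P ^ 2 := by rw [pow_two]; exact mul_mem_mul h1 hx
  convert add_mem (hc x hx) h2 using 1
  ring

/-- Let `g` and `h` be commuting elements of the inertia group, both killed by a prime `l` different
from the residue characteristic. Then `h` is a power of `g` if `g` is not trivial: the scalars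
by which they act on `P ⧸ P ^ 2` are `l`-th roots of unity in the residue field, and determine
`g` and `h`. -/
theorem exists_eq_pow_of_mem_inertia [IsDedekindDomain S] [FaithfulSMul G S] [P.IsPrime]
    (hP : P ≠ ⊥) (hg : g ∈ P.inertia G) (hh : h ∈ P.inertia G) (hcomm : Commute h g) {l : ℕ}
    (hl : l.Prime) (hlP : (l : S) ∉ P) (hgl : g ^ l = 1) (hhl : h ^ l = 1) (hg1 : g ≠ 1) :
    ∃ i, h = g ^ i := by
  obtain ⟨c, hc⟩ := exists_smul_sub_mul_mem_sq hP hg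
  obtain ⟨d, hd⟩ := exists_smul_sub_mul_mem_sq hP hh
  have hcl := quotient_mk_pow_eq_one hP hg hc hgl
  have hc1 : Ideal.Quotient.mk P c ≠ 1 := fun h1 => hg1 <|
    eq_one_of_pow_eq_one_of_smul_sub_mem_sq hg (smul_sub_mem_sq_of_quotient_mk_eq_one hc h1)
      hlP hgl
  have := Fact.mk hl
  have hprim : IsPrimitiveRoot (Ideal.Quotient.mk P c) l := by
    rw [← orderOf_eq_prime hcl hc1]
    exact IsPrimitiveRoot.orderOf _
  have : NeZero l := ⟨hl.ne_zero⟩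
  obtain ⟨i, hi, hcd⟩ := hprim.eq_pow_of_pow_eq_one (quotient_mk_pow_eq_one hP hh hd hhl)
  refine ⟨i, ?_⟩
  -- `h * g ^ (l - i)` acts on `P ⧸ P ^ 2` by the scalar `c ^ i * c ^ (l - i) = 1`.
  have hu := mul_smul_sub_mul_mem_sq (pow_mem hg (l - i)) hd (pow_smul_sub_mul_mem_sq hg hc (l - i))
  have hu1 : h * g ^ (l - i) = 1 := by
    refine eq_one_of_pow_eq_one_of_smul_sub_mem_sq (mul_mem hh (pow_mem hg _))
      (smul_sub_mem_sq_of_quotient_mk_eq_one hu ?_) hlP ?_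
    · rw [map_mul, map_pow, ← hcd, ← pow_add, Nat.add_sub_cancel' hi.le, hcl]
    · rw [(hcomm.pow_right _).mul_pow, hhl, ← pow_mul, mul_comm, pow_mul, hgl, one_pow, one_mul]
  rw [eq_inv_of_mul_eq_one_left hu1, inv_eq_iff_mul_eq_one, ← pow_add, Nat.sub_add_cancel hi.le,
    hgl]

end InertiaAction

end Ideal

namespace PolyaGroup

open Ideal

/-! ### Ostrowski ideals of Galois number fields -/

section Ostrowski

theorem isMaximal_span_natCast {p : ℕ} (hp : p.Prime) : (span {(p : ℤ)}).IsMaximal :=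
  (Nat.prime_iff_prime_int.mp hp).isMaximal_span_singleton

theorem isMaximal_of_mem_primesOver {K : Type*} [Field K] {p : ℕ} (hp : p.Prime)
    {P : Ideal (𝓞 K)}
    (hP : P ∈ (span {(p : ℤ)}).primesOver (𝓞 K)) : P.IsMaximal := by
  have := isMaximal_span_natCast hp
  have := hP.1
  have := hP.2
  exact IsMaximal.of_liesOver_isMaximal P (span {(p : ℤ)})

theorem mem_primesOver_span_iff {K : Type*} [Field K] {p : ℕ} (hp : p.Prime)
    {P : Ideal (𝓞 K)} :
    P ∈ (span {(p : ℤ)}).primesOver (𝓞 K) ↔ P.IsPrime ∧ (p : 𝓞 K) ∈ P := by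
  refine and_congr_right fun h => ?_
  rw [liesOver_span_iff h.ne_top (Nat.prime_iff_prime_int.mp hp)]
  simp

variable (K : Type*) [Field K] [NumberField K]

/-- The product of all prime ideals of `𝓞 K` above the rational prime `p`, that is, of all
prime ideals that lie over the ideal of `ℤ` generated by `p`. -/
noncomputable def primesOverProd (p : ℕ) : Ideal (𝓞 K) :=
  ∏ᶠ P ∈ (span {(p : ℤ)}).primesOver (𝓞 K), P

variable {K}

theorem exists_mem_primesOver_span {p : ℕ} (hp : p.Prime) :
    ∃ P : Ideal (𝓞 K), P ∈ (span {(p : ℤ)}).primesOver (𝓞 K) := by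
  have := isMaximal_span_natCast hp
  obtain ⟨P⟩ := (inferInstance : Nonempty ((span {(p : ℤ)}).primesOver (𝓞 K)))
  exact ⟨P.1, P.2⟩

/-- The primes above `p` have the same norm because the Galois group permutes them transitively, and
this norm is a power of `p`, which determines `p`. -/
theorem setOf_card_quotient_eq_primesOver [IsGalois ℚ K] {p : ℕ} (hp : p.Prime)
    {P₀ : Ideal (𝓞 K)} (hP₀ : P₀ ∈ (span {(p : ℤ)}).primesOver (𝓞 K)) :
    {m : Ideal (𝓞 K) | m.IsMaximal ∧ Nat.card (𝓞 K ⧸ m) = absNorm P₀} =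
      (span {(p : ℤ)}).primesOver (𝓞 K) := by
  have hpmax := isMaximal_span_natCast hp
  have hP₀max := isMaximal_of_mem_primesOver hp hP₀
  have := hP₀.2
  ext m
  constructor
  · rintro ⟨hm, hcard⟩
    obtain ⟨l, n, hn, hlm, hl, hln⟩ := exists_prime_and_absNorm_eq_pow m
    have h1 : l ^ n = p ^ (span {(p : ℤ)}).inertiaDeg' P₀ := by
      rw [← absNorm_eq_pow_inertiaDeg' P₀ hp, ← hcard, ← hln]
      rfl
    have hlp : l = p := (Nat.prime_dvd_prime_iff_eq hl hp).mp <|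
      hl.dvd_of_dvd_pow (h1 ▸ dvd_pow_self l hn.ne')
    exact (mem_primesOver_span_iff hp).mpr ⟨hm.isPrime, hlp ▸ hlm⟩
  · intro hm
    have hmmax := isMaximal_of_mem_primesOver hp hm
    have := hm.2
    refine ⟨hmmax, ?_⟩
    change absNorm m = absNorm P₀
    rw [absNorm_eq_pow_inertiaDeg' m hp, absNorm_eq_pow_inertiaDeg' P₀ hp,
      inertiaDeg'_eq_inertiaDeg, inertiaDeg'_eq_inertiaDeg,
      inertiaDeg_eq_of_isGaloisGroup (span {(p : ℤ)}) m P₀ Gal(K/ℚ)]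

theorem ostrowskiIdeal_absNorm [IsGalois ℚ K] {p : ℕ} (hp : p.Prime)
    {P₀ : Ideal (𝓞 K)} (hP₀ : P₀ ∈ (span {(p : ℤ)}).primesOver (𝓞 K)) :
    ostrowskiIdeal K (absNorm P₀) = primesOverProd K p := by
  rw [ostrowskiIdeal, setOf_card_quotient_eq_primesOver hp hP₀, primesOverProd]

theorem ostrowskiIdeal_eq_one_or [IsGalois ℚ K] (q : ℕ) :
    ostrowskiIdeal K q = 1 ∨ ∃ p : ℕ, p.Prime ∧ ostrowskiIdeal K q = primesOverProd K p := by
  by_cases h : ∃ m : Ideal (𝓞 K), m.IsMaximal ∧ Nat.card (𝓞 K ⧸ m) = q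
  · obtain ⟨m, hm, rfl⟩ := h
    obtain ⟨p, n, hn, hpm, hp, hpn⟩ := exists_prime_and_absNorm_eq_pow m
    exact Or.inr ⟨p, hp, ostrowskiIdeal_absNorm hp
      ((mem_primesOver_span_iff hp).mpr ⟨hm.isPrime, hpm⟩)⟩
  · left
    have hempty : {m : Ideal (𝓞 K) | m.IsMaximal ∧ Nat.card (𝓞 K ⧸ m) = q} = ∅ :=
      Set.eq_empty_of_forall_notMem fun m hm => h ⟨m, hm⟩
    rw [ostrowskiIdeal, hempty, finprod_mem_empty]

theorem exists_ostrowskiIdeal_eq_primesOverProd [IsGalois ℚ K] {p : ℕ} (hp : p.Prime) :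
    ∃ q : ℕ, 0 < q ∧ ostrowskiIdeal K q = primesOverProd K p := by
  obtain ⟨P, hP⟩ := exists_mem_primesOver_span (K := K) hp
  have := isMaximal_of_mem_primesOver hp hP
  refine ⟨absNorm P, Nat.pos_of_ne_zero ?_, ostrowskiIdeal_absNorm hp hP⟩
  rw [Ne, absNorm_eq_zero_iff]
  exact IsMaximal.ne_bot_of_isIntegral_int P

theorem primesOverProd_mem [IsGalois ℚ K] {p : ℕ} (hp : p.Prime) :
    primesOverProd K p ∈ (Ideal (𝓞 K))⁰ := by
  obtain ⟨q, -, hq⟩ := exists_ostrowskiIdeal_eq_primesOverProd (K := K) hp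
  exact hq ▸ ostrowskiIdeal_mem K q

/-- For a Galois number field, the Pólya group is generated by the classes of the products of the
primes above the rational primes. -/
theorem polyaGroup_eq_closure (K : Type*) [Field K] [NumberField K] [IsGalois ℚ K] :
    polyaGroup K = Subgroup.closure
      {c | ∃ (p : ℕ) (hp : p.Prime),
        c = ClassGroup.mk0 ⟨primesOverProd K p, primesOverProd_mem hp⟩} := by
  refine le_antisymm ((Subgroup.closure_le _).mpr ?_) (Subgroup.closure_mono ?_)
  · rintro _ ⟨q, hq, rfl⟩
    rcases ostrowskiIdeal_eq_one_or (K := K) q with h | ⟨p, hp, h⟩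
    · have h1 : (⟨ostrowskiIdeal K q, ostrowskiIdeal_mem K q⟩ : (Ideal (𝓞 K))⁰) = 1 :=
        Subtype.ext h
      rw [h1, map_one]
      exact one_mem _
    · exact Subgroup.subset_closure ⟨p, hp, congrArg ClassGroup.mk0 (Subtype.ext h)⟩
  · rintro _ ⟨p, hp, rfl⟩
    obtain ⟨q, hq, h⟩ := exists_ostrowskiIdeal_eq_primesOverProd (K := K) hp
    exact ⟨q, hq, congrArg ClassGroup.mk0 (Subtype.ext h.symm)⟩

/-- A rational prime `p` generates in a Galois number field the `e`-th power of the product of the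
primes above it, where `e` is their common ramification index. -/
theorem map_span_eq_primesOverProd_pow [IsGalois ℚ K] {p : ℕ} (hp : p.Prime) {P : Ideal (𝓞 K)}
    (hP : P ∈ (span {(p : ℤ)}).primesOver (𝓞 K)) :
    (span {(p : ℤ)}).map (algebraMap ℤ (𝓞 K)) = primesOverProd K p ^ P.ramificationIdx ℤ := by
  have := isMaximal_span_natCast hp
  have hp0 : span {(p : ℤ)} ≠ 0 := by simpa using hp.ne_zero
  have := hP.1
  have := hP.2
  rw [map_algebraMap_eq_finsetProd_pow hp0, primesOverProd, finprod_mem_eq_toFinset_prod,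
    ← Finset.prod_pow]
  refine Finset.prod_congr rfl fun Q hQ => ?_
  have hQ' : Q ∈ (span {(p : ℤ)}).primesOver (𝓞 K) := by simpa using hQ
  have := hQ'.1
  have := hQ'.2
  rw [ramificationIdx_eq_of_isGaloisGroup (span {(p : ℤ)}) P Q Gal(K/ℚ)]

/-- In a tower of Galois number fields, the product of the primes above `p` extends to the power of
the product of the primes above `p` whose exponent is the relative ramification index: both ideals
have the same power of exponent the ramification index over `ℚ` of the lower field. -/
theorem map_primesOverProd {K L : Type*} [Field K] [NumberField K] [Field L] [NumberField L]
    [Algebra K L] [IsGalois ℚ K] [IsGalois ℚ L] {p : ℕ} (hp : p.Prime) {P : Ideal (𝓞 L)}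
    (hP : P ∈ (span {(p : ℤ)}).primesOver (𝓞 L)) :
    (primesOverProd K p).map (algebraMap (𝓞 K) (𝓞 L)) =
      primesOverProd L p ^ P.ramificationIdx (𝓞 K) := by
  have := hP.1
  have := hP.2
  have hPK : P.under (𝓞 K) ∈ (span {(p : ℤ)}).primesOver (𝓞 K) :=
    ⟨inferInstance, LiesOver.tower_bot P (P.under (𝓞 K)) (span {(p : ℤ)})⟩
  -- Ideals of `𝓞 L` have unique roots.
  refine pow_left_injective ((P.under (𝓞 K)).ramificationIdx_pos ℤ).ne' ?_
  dsimp only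
  rw [← Ideal.map_pow, ← map_span_eq_primesOverProd_pow hp hPK, map_map,
    ← IsScalarTower.algebraMap_eq, map_span_eq_primesOverProd_pow hp hP, ← pow_mul, mul_comm,
    ← ramificationIdx_tower]

theorem extendedHom_mk0_primesOverProd {K L : Type*} [Field K] [NumberField K] [Field L]
    [NumberField L] [Algebra K L] [IsGalois ℚ K] [IsGalois ℚ L] {p : ℕ} (hp : p.Prime)
    {P : Ideal (𝓞 L)} (hP : P ∈ (span {(p : ℤ)}).primesOver (𝓞 L)) :
    ClassGroup.extendedHom (𝓞 K) (𝓞 L)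
        (ClassGroup.mk0 ⟨primesOverProd K p, primesOverProd_mem hp⟩) =
      ClassGroup.mk0 ⟨primesOverProd L p, primesOverProd_mem hp⟩ ^ P.ramificationIdx (𝓞 K) := by
  rw [ClassGroup.extendedHom_mk0, ← map_pow]
  exact congrArg ClassGroup.mk0 (Subtype.ext (map_primesOverProd hp hP))

end Ostrowski

/-! ### Ramification indices in a compositum -/

section Compositum

/-- On an intermediate field `K` of `L / ℚ`, the `ℚ`-algebra structure as a field of characteristic
zero and the one as an intermediate field agree, but not by definition. -/
theorem isGalois_algebra' {L : Type*} [Field L] [CharZero L] (K : IntermediateField ℚ L)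
    [h : IsGalois ℚ K] : @IsGalois ℚ _ K _ K.algebra' := by
  convert h
  exact Subsingleton.elim _ _

theorem disjoint_fixingSubgroup {F L : Type*} [Field F] [Field L] [Algebra F L]
    {K₁ K₂ : IntermediateField F L} (hL : K₁ ⊔ K₂ = ⊤) :
    Disjoint K₁.fixingSubgroup K₂.fixingSubgroup := by
  rw [disjoint_iff, ← IntermediateField.fixingSubgroup_sup, hL,
    IntermediateField.fixingSubgroup_top]

variable {L : Type*} [Field L] [NumberField L] [IsGalois ℚ L]

theorem card_inertia_inf_fixingSubgroup (K : IntermediateField ℚ L) (P : Ideal (𝓞 L))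
    [P.IsPrime] :
    Nat.card ↥(P.inertia Gal(L/ℚ) ⊓ K.fixingSubgroup) = P.ramificationIdx (𝓞 K) := by
  have : IsGaloisGroup K.fixingSubgroup K L :=
    IsGaloisGroup.intermediateField (G := Gal(L/ℚ)) (K := ℚ) (L := L) K
  have : IsGaloisGroup K.fixingSubgroup (𝓞 K) (𝓞 L) :=
    IsGaloisGroup.of_isFractionRing K.fixingSubgroup (𝓞 K) (𝓞 L) K L
  rw [← ramificationIdxIn_eq_ramificationIdx (P.under (𝓞 K)) P K.fixingSubgroup,
    ← card_inertia_eq_ramificationIdxIn (G := K.fixingSubgroup) (P.under (𝓞 K)) P]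
  have h : P.inertia K.fixingSubgroup = (P.inertia Gal(L/ℚ)).subgroupOf K.fixingSubgroup := by
    ext σ
    rw [Subgroup.mem_subgroupOf, coe_mem_inertia]
  rw [h, ← Subgroup.inf_subgroupOf_right]
  exact Nat.card_congr (Subgroup.subgroupOfEquivOfLe inf_le_right).toEquiv.symm

variable {K₁ K₂ : IntermediateField ℚ L} [IsGalois ℚ K₁] [IsGalois ℚ K₂]

theorem commute_of_mem_fixingSubgroup (hL : K₁ ⊔ K₂ = ⊤) {σ τ : Gal(L/ℚ)}
    (hσ : σ ∈ K₁.fixingSubgroup) (hτ : τ ∈ K₂.fixingSubgroup) : Commute σ τ :=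
  have := isGalois_algebra' K₁
  have := isGalois_algebra' K₂
  Subgroup.commute_of_normal_of_disjoint _ _
    (IsGalois.fixingSubgroup_normal_of_isGalois K₁) (IsGalois.fixingSubgroup_normal_of_isGalois K₂)
    (disjoint_fixingSubgroup hL) σ τ hσ hτ

/-- The inertia groups over `K₁` and over `K₂` commute and meet trivially, so that their product is
a subgroup of the inertia group over `K₀`. -/
theorem ramificationIdx_mul_ramificationIdx_dvd (hL : K₁ ⊔ K₂ = ⊤) {K₀ : IntermediateField ℚ L}
    (h₁ : K₀ ≤ K₁) (h₂ : K₀ ≤ K₂) (P : Ideal (𝓞 L)) [P.IsPrime] :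
    P.ramificationIdx (𝓞 K₁) * P.ramificationIdx (𝓞 K₂) ∣ P.ramificationIdx (𝓞 K₀) := by
  simp only [← card_inertia_inf_fixingSubgroup, ← Nat.card_prod]
  have hle {K : IntermediateField ℚ L} (h : K₀ ≤ K) :
      P.inertia Gal(L/ℚ) ⊓ K.fixingSubgroup ≤ P.inertia Gal(L/ℚ) ⊓ K₀.fixingSubgroup :=
    inf_le_inf_left _ (IntermediateField.fixingSubgroup_antitone h)
  have hcomm (σ : ↥(P.inertia Gal(L/ℚ) ⊓ K₁.fixingSubgroup))
      (τ : ↥(P.inertia Gal(L/ℚ) ⊓ K₂.fixingSubgroup)) :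
      Commute (Subgroup.inclusion (hle h₁) σ) (Subgroup.inclusion (hle h₂) τ) :=
    Subtype.ext (commute_of_mem_fixingSubgroup hL σ.2.2 τ.2.2)
  refine Subgroup.card_dvd_of_injective _
    ((MonoidHom.noncommCoprod_injective _ _ hcomm).mpr
      ⟨Subgroup.inclusion_injective _, Subgroup.inclusion_injective _, ?_⟩)
  rw [Subgroup.disjoint_def]
  rintro _ ⟨σ, rfl⟩ ⟨τ, h⟩
  have hστ : (τ : Gal(L/ℚ)) = σ := congrArg Subtype.val h
  exact Subtype.ext <| Subgroup.disjoint_def.mp (disjoint_fixingSubgroup hL) σ.2.2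
    (hστ ▸ τ.2.2)

/-- Tameness of `K₁ / K₀` is inherited by `L / K₂`. -/
theorem not_dvd_ramificationIdx_of_tamelyRamifiedAtOfLE (hL : K₁ ⊔ K₂ = ⊤)
    {K₀ : IntermediateField ℚ L} (h₁ : K₀ ≤ K₁) (h₂ : K₀ ≤ K₂) {p : ℕ}
    (htame : TamelyRamifiedAtOfLE h₁ p) (P : Ideal (𝓞 L)) [P.IsPrime] (hpP : (p : 𝓞 L) ∈ P) :
    ¬ p ∣ P.ramificationIdx (𝓞 K₂) := by
  let _ : Algebra K₀ K₁ := (IntermediateField.inclusion h₁).toRingHom.toAlgebra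
  have : IsScalarTower K₀ K₁ L := IsScalarTower.of_algebraMap_eq fun x => rfl
  have htower := ramificationIdx_tower (R := 𝓞 K₀) (P.under (𝓞 K₁)) P
  have hdvd := ramificationIdx_mul_ramificationIdx_dvd hL h₁ h₂ P
  rw [htower, mul_comm, Nat.mul_dvd_mul_iff_right (P.ramificationIdx_pos (𝓞 K₁))] at hdvd
  exact fun h => htame (P.under (𝓞 K₁)) inferInstance (by simpa using hpP) (h.trans hdvd)

/-- A form of Abhyankar's lemma: if `K₁` or `K₂` is tame over `K₁ ⊓ K₂` at `p`, the ramification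
indices above `p` of the compositum over `K₁` and over `K₂` are coprime. A common prime factor `l`
differs from `p`, and yields elements of order `l` in the inertia groups over `K₁` and over `K₂`.
One of them is a power of the other, although the two inertia groups meet trivially. -/
theorem coprime_ramificationIdx (hL : K₁ ⊔ K₂ = ⊤) {p : ℕ} (hp : p.Prime)
    (htame : TamelyRamifiedAtOfLE (inf_le_left : K₁ ⊓ K₂ ≤ K₁) p ∨
      TamelyRamifiedAtOfLE (inf_le_right : K₁ ⊓ K₂ ≤ K₂) p)
    (P : Ideal (𝓞 L)) [P.IsPrime] (hpP : (p : 𝓞 L) ∈ P) :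
    Nat.Coprime (P.ramificationIdx (𝓞 K₁)) (P.ramificationIdx (𝓞 K₂)) := by
  refine Nat.Coprime.symm (Nat.coprime_of_dvd fun l hl hl₂ hl₁ => ?_)
  have hlp : l ≠ p := by
    rintro rfl
    rcases htame with h | h
    · exact not_dvd_ramificationIdx_of_tamelyRamifiedAtOfLE hL _ inf_le_right h P hpP hl₂
    · exact not_dvd_ramificationIdx_of_tamelyRamifiedAtOfLE (sup_comm K₁ K₂ ▸ hL) _ inf_le_left
        h P hpP hl₁
  -- If `P` contained both `l` and `p`, it would contain `1`.
  have hlP : (l : 𝓞 L) ∉ P := fun hlP => by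
    have hcop := ((Nat.coprime_primes hl hp).mpr hlp).cast (R := 𝓞 L)
    obtain ⟨a, b, hab⟩ := hcop
    exact IsPrime.ne_top' (P.eq_top_iff_one.mpr
      (hab ▸ add_mem (P.mul_mem_left a hlP) (P.mul_mem_left b hpP)))
  have hP : P ≠ ⊥ := by
    rintro rfl
    exact hp.ne_zero (by simpa using hpP)
  rw [← card_inertia_inf_fixingSubgroup] at hl₁ hl₂
  have := Fact.mk hl
  obtain ⟨σ, hσ⟩ := exists_prime_orderOf_dvd_card' l hl₁
  obtain ⟨τ, hτ⟩ := exists_prime_orderOf_dvd_card' l hl₂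
  rw [← Subgroup.orderOf_coe] at hσ hτ
  have hne {ρ : Gal(L/ℚ)} (hρ : orderOf ρ = l) : ρ ≠ 1 := by
    rintro rfl
    exact hl.one_lt.ne (by simpa using hρ)
  have : FaithfulSMul Gal(L/ℚ) (𝓞 L) :=
    (inferInstance : IsGaloisGroup Gal(L/ℚ) ℤ (𝓞 L)).faithful
  obtain ⟨i, hi⟩ := exists_eq_pow_of_mem_inertia hP σ.2.1 τ.2.1
    (commute_of_mem_fixingSubgroup hL σ.2.2 τ.2.2).symm hl hlP
    (hσ ▸ pow_orderOf_eq_one _) (hτ ▸ pow_orderOf_eq_one _) (hne hσ)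
  exact hne hτ <| Subgroup.disjoint_def.mp (disjoint_fixingSubgroup hL)
    (hi ▸ pow_mem σ.2.2 i) τ.2.2

end Compositum

/-! ### Pólya groups in an extension of Galois number fields -/

theorem map_extendedHom_polyaGroup_le {K L : Type*} [Field K] [NumberField K] [Field L]
    [NumberField L] [Algebra K L] [IsGalois ℚ K] [IsGalois ℚ L] :
    (polyaGroup K).map (ClassGroup.extendedHom (𝓞 K) (𝓞 L)) ≤ polyaGroup L := by
  rw [Subgroup.map_le_iff_le_comap, polyaGroup_eq_closure K, Subgroup.closure_le]
  rintro _ ⟨p, hp, rfl⟩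
  obtain ⟨P, hP⟩ := exists_mem_primesOver_span (K := L) hp
  rw [SetLike.mem_coe, Subgroup.mem_comap, extendedHom_mk0_primesOverProd hp hP,
    polyaGroup_eq_closure L]
  refine pow_mem ?_ _
  exact Subgroup.subset_closure ⟨p, hp, rfl⟩

end PolyaGroup

theorem mainTheorem3 {L : Type*} [Field L] [NumberField L] (K₁ K₂ : IntermediateField ℚ L)
    [IsGalois ℚ K₁] [IsGalois ℚ K₂] (hL : K₁ ⊔ K₂ = ⊤)
    (htame : ∀ p : ℕ, p.Prime →
      PolyaGroup.TamelyRamifiedAtOfLE (inf_le_left : K₁ ⊓ K₂ ≤ K₁) p ∨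
      PolyaGroup.TamelyRamifiedAtOfLE (inf_le_right : K₁ ⊓ K₂ ≤ K₂) p) :
    PolyaGroup.polyaGroup L =
      (PolyaGroup.polyaGroup K₁).map (ClassGroup.extendedHom (𝓞 K₁) (𝓞 L)) ⊔
      (PolyaGroup.polyaGroup K₂).map (ClassGroup.extendedHom (𝓞 K₂) (𝓞 L)) := by
  have : IsGalois ℚ L := by
    have := PolyaGroup.isGalois_algebra' K₁
    have := PolyaGroup.isGalois_algebra' K₂
    rw [← isGalois_iff_isGalois_top, ← hL]
    infer_instance
  refine le_antisymm ?_ (sup_le PolyaGroup.map_extendedHom_polyaGroup_le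
    PolyaGroup.map_extendedHom_polyaGroup_le)
  rw [PolyaGroup.polyaGroup_eq_closure L, Subgroup.closure_le]
  rintro _ ⟨p, hp, rfl⟩
  obtain ⟨P, hP⟩ := PolyaGroup.exists_mem_primesOver_span (K := L) hp
  have hP' := (PolyaGroup.mem_primesOver_span_iff hp).mp hP
  have := hP'.1
  have hcop := PolyaGroup.coprime_ramificationIdx hL hp (htame p hp) P hP'.2
  set c := ClassGroup.mk0 (⟨PolyaGroup.primesOverProd L p, PolyaGroup.primesOverProd_mem hp⟩ :
    (Ideal (𝓞 L))⁰) with hc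
  have hmem {K : IntermediateField ℚ L} [IsGalois ℚ K] :
      c ^ P.ramificationIdx (𝓞 K) ∈
        (PolyaGroup.polyaGroup K).map (ClassGroup.extendedHom (𝓞 K) (𝓞 L)) := by
    rw [hc, ← PolyaGroup.extendedHom_mk0_primesOverProd (K := K) hp hP]
    refine Subgroup.mem_map_of_mem _ ?_
    rw [PolyaGroup.polyaGroup_eq_closure K]
    exact Subgroup.subset_closure ⟨p, hp, rfl⟩
  -- A Bézout relation between the two coprime exponents recovers `c` from these two powers.
  have hbez : c = (c ^ P.ramificationIdx (𝓞 K₁)) ^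
        (P.ramificationIdx (𝓞 K₁)).gcdA (P.ramificationIdx (𝓞 K₂)) *
      (c ^ P.ramificationIdx (𝓞 K₂)) ^
        (P.ramificationIdx (𝓞 K₁)).gcdB (P.ramificationIdx (𝓞 K₂)) := by
    rw [← zpow_natCast, ← zpow_natCast, ← zpow_mul, ← zpow_mul, ← zpow_add, ← Nat.gcd_eq_gcd_ab,
      hcop.gcd_eq_one, Nat.cast_one, zpow_one]
  rw [SetLike.mem_coe, hbez]
  exact mul_mem (Subgroup.mem_sup_left (zpow_mem hmem _)) (Subgroup.mem_sup_right (zpow_mem hmem _))
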